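/- Lemma 31. A $3$-dimensional VASS $V=(Q,T)$ consists of a finite set $Q$ of states and a finite set $T\subseteq Q\times\mathbb{Z}^3\times Q$ of transitions. A configuration $q(w)$ is a state $q \in Q$ together with a vector $w\in\mathbb{N}^3$; a transition $(q,v,q')\in T$ induces the step $q(w)\to q'(w+v)$ whenever $w,w+v\in\mathbb{N}^3$; a path is a sequence of consecutive steps, and a configuration is reachable from $s$ if there is a path from $s$ to it. The norm of a vector is the sum of the absolute values of its entries, and the norm of a transition or configuration is the norm of its vector. For a source configuration $s$, $\mathrm{size}(V,s)$ is the sum of the norms of all transitions of $V$, plus the number of transitions, plus the norm of $s$. $V$ is sequential, $V=(V_1)u_1(V_2)u_2\ldots u_{k-1}(V_k)$ with $k \geq 1$, if it is partitioned into strongly connected VASS $V_1,\ldots,V_k$ (the components) with pairwise disjoint state sets and single transitions $u_1,\ldots,u_{k-1}$ (the bridges), where $u_i$ leads from a state of $V_i$ to a state of $V_{i+1}$. A pair $(V,s)$ with $s=p(w)$ is forward-diagonal if $p(w+\Delta)$ is reachable from $p(w)$ in $V$ for some $\Delta\in(\mathbb{N}_{>0})^3$. Let $\mathrm{cone}(V_i)=\{r_1e_1+\ldots+r_ne_n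 \mid r_1,\ldots,r_n\in\mathbb{Q}_{>0}\}$, where $e_1,\ldots,e_n\in\mathbb{Z}^3$ are the effects of the simple cycles of $V_i$ (this is $\{0\}$ if there are none), and let $\mathrm{seqcone}(V)$ be the set of all sums $v_1+\ldots+v_k$ such that $v_i\in\mathrm{cone}(V_i)$ and $v_1+\ldots+v_i\in(\mathbb{Q}_{>0})^3$ for every $i\in\{1,\ldots,k\}$. Let $d(x,S)=\inf\{d(x,y)\mid y\in S\}$, where $d(x,y)$ is the Euclidean distance. There exists a polynomial $P:\mathbb{N}\to\mathbb{N}$, with $P(n)\ge n$ for all $n$ and $P(n)<P(m)$ for all $n<m$, such that for every sequential $3$-dimensional VASS $V=(V_1)u_1\ldots u_{k-1}(V_k)$ (with any number $k$ of components) and every configuration $s$ whose state belongs to the first component $V_1$, if $(V,s)$ is forward-diagonal then $\mathrm{seqcone}(V)$ is nonempty and every configuration $q(w)$ reachable from $s$ in $V$ satisfies $$d(w,\mathrm{seqcone}(V))\le P(\mathrm{size}(V,s)).$$ -/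

import Mathlib

/-- A transition `(q, v, q')` over the state type `σ`, with effect `v ∈ ℤ^d`. -/
@[ext]
structure Transition (d : ℕ) (σ : Type*) where
  src : σ
  eff : Fin d → ℤ
  tgt : σ

/-- A `d`-dimensional vector addition system with states: a finite set of states and a finite
set of transitions between them. -/
structure VASS (d : ℕ) (σ : Type*) where
  states : Finset σ
  trans : Finset (Transition d σ)
  src_mem : ∀ t ∈ trans, t.src ∈ states
  tgt_mem : ∀ t ∈ trans, t.tgt ∈ states

/-- A configuration `q(w)`: a state together with a nonnegative integer vector. -/
@[ext]
structure Config (d : ℕ) (σ : Type*) where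
  state : σ
  vec : Fin d → ℕ

/-- The norm of an integer vector: the sum of absolute values of its entries. -/
def vecNorm {d : ℕ} (v : Fin d → ℤ) : ℕ := ∑ i, (v i).natAbs

/-- The norm of a configuration is the norm of its vector. -/
def Config.norm {d : ℕ} {σ : Type*} (c : Config d σ) : ℕ := vecNorm fun i => (c.vec i : ℤ)

namespace VASS

variable {d : ℕ} {σ : Type*}

/-- The size of a VASS: the sum of norms of its transitions plus the number of transitions. -/
def size (V : VASS d σ) : ℕ := (∑ t ∈ V.trans, vecNorm t.eff) + V.trans.card

/-- The size of a VASS with a source configuration. -/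
def sizeWith (V : VASS d σ) (s : Config d σ) : ℕ := V.size + s.norm

/-- The step `c → c'` induced by the transition `t` of `V`. -/
def Step (V : VASS d σ) (c : Config d σ) (t : Transition d σ) (c' : Config d σ) : Prop :=
  t ∈ V.trans ∧ t.src = c.state ∧ t.tgt = c'.state ∧
    ∀ i, (c'.vec i : ℤ) = (c.vec i : ℤ) + t.eff i

/-- `V.Path c π c'`: firing the sequence of transitions `π` is a path of `V` from `c` to `c'`
(all configurations along the path are nonnegative). -/
inductive Path (V : VASS d σ) : Config d σ → List (Transition d σ) → Config d σ → Prop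
  | nil (c : Config d σ) (hc : c.state ∈ V.states) : Path V c [] c
  | cons {c c' c'' : Config d σ} {t : Transition d σ} {π : List (Transition d σ)}
      (h : V.Step c t c') (hπ : Path V c' π c'') : Path V c (t :: π) c''

/-- `t` is reachable from `s` in `V`. -/
def Reachable (V : VASS d σ) (s t : Config d σ) : Prop := ∃ π, V.Path s π t

/-- The effect of a sequence of transitions. -/
def effect (π : List (Transition d σ)) : Fin d → ℤ := (π.map Transition.eff).sum

/-- `π` is (the sequence of transitions of) a simple cycle of `V`: a nonempty path whose source
and target configurations have the same state, with no other equality of states along it. -/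
def IsSimpleCycle (V : VASS d σ) (π : List (Transition d σ)) : Prop :=
  π ≠ [] ∧ (∃ c c' : Config d σ, c.state = c'.state ∧ V.Path c π c') ∧
    (π.map Transition.src).Nodup

/-- The set of effects of simple cycles of `V`. -/
def simpleCycleEffects (V : VASS d σ) : Set (Fin d → ℤ) :=
  {e | ∃ π, V.IsSimpleCycle π ∧ effect π = e}

theorem Path.mem_trans {V : VASS d σ} {c c' : Config d σ} {π : List (Transition d σ)}
    (h : V.Path c π c') : ∀ t ∈ π, t ∈ V.trans := by
  induction h with
  | nil => simp
  | cons h _ ih =>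
    intro t ht
    rcases List.mem_cons.1 ht with rfl | ht
    · exact h.1
    · exact ih t ht

theorem simpleCycleEffects_finite (V : VASS d σ) : V.simpleCycleEffects.Finite := by
  have h := ((List.finite_length_le {t // t ∈ V.trans} V.trans.card).image
    (List.map Subtype.val)).image effect
  refine h.subset ?_
  rintro e ⟨π, ⟨-, ⟨c, c', -, hp⟩, hnd⟩, rfl⟩
  have hm := hp.mem_trans
  refine ⟨π, ⟨π.attachWith _ hm, ?_, by simp⟩, rfl⟩
  have hnd' : (π.attachWith _ hm).Nodup :=
    List.Nodup.of_map Subtype.val (by simpa using hnd.of_map)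
  simpa using hnd'.length_le_card

/-- The rational open cone generated by the effects of simple cycles of `V`: all combinations
of these effects with positive rational coefficients (it is `{0}` if there is no cycle). -/
def cone (V : VASS d σ) : Set (Fin d → ℚ) :=
  {x | ∃ r : (Fin d → ℤ) → ℚ, (∀ e ∈ V.simpleCycleEffects, 0 < r e) ∧
    x = ∑ e ∈ V.simpleCycleEffects_finite.toFinset, r e • (fun i => (e i : ℚ))}

/-- The edges of the state graph of `V`. -/
def Edge (V : VASS d σ) (p q : σ) : Prop := ∃ t ∈ V.trans, t.src = p ∧ t.tgt = q

/-- The state graph of `V` is strongly connected. -/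
def StronglyConnected (V : VASS d σ) : Prop :=
  ∀ p ∈ V.states, ∀ q ∈ V.states, Relation.ReflTransGen V.Edge p q

/-- `(V, s)` is forward-diagonal: `s = p(w)` can reach some `p(w + Δ)` with `Δ` positive on
every coordinate. -/
def ForwardDiagonal (V : VASS d σ) (s : Config d σ) : Prop :=
  ∃ Δ : Fin d → ℕ, (∀ i, 0 < Δ i) ∧ V.Reachable s ⟨s.state, s.vec + Δ⟩

/-- A presentation `V = (V_1) u_1 (V_2) u_2 … u_{k-1} (V_k)` of `V` as a sequential VASS with
`k = m + 1` strongly connected components (here indexed from `0`) and `m` bridges. -/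
structure Sequential (V : VASS d σ) where
  m : ℕ
  comp : Fin (m + 1) → VASS d σ
  bridge : Fin m → Transition d σ
  stronglyConnected : ∀ i, (comp i).StronglyConnected
  disjoint : ∀ i j, i ≠ j → Disjoint (comp i).states (comp j).states
  bridge_src : ∀ i : Fin m, (bridge i).src ∈ (comp i.castSucc).states
  bridge_tgt : ∀ i : Fin m, (bridge i).tgt ∈ (comp i.succ).states
  states_eq : ∀ q, q ∈ V.states ↔ ∃ i, q ∈ (comp i).states
  trans_eq : ∀ t, t ∈ V.trans ↔ (∃ i, t ∈ (comp i).trans) ∨ ∃ i, t = bridge i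

/-- A tuple of vectors is a cascade if all its (nonempty) partial sums are positive on every
coordinate. -/
def IsCascade {k : ℕ} (v : Fin k → Fin d → ℚ) : Prop :=
  ∀ i j, 0 < (∑ l ∈ Finset.Iic i, v l) j

/-- The sequential cone: the set of sums of all cascades whose `i`-th vector belongs to the
cone of the `i`-th component. -/
def Sequential.seqCone {V : VASS d σ} (S : V.Sequential) : Set (Fin d → ℚ) :=
  {x | ∃ v : Fin (S.m + 1) → Fin d → ℚ,
    (∀ i, v i ∈ (S.comp i).cone) ∧ IsCascade v ∧ x = ∑ i, v i}

end VASS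

/-- A rational vector as a point of Euclidean space. -/
noncomputable def toEuclid {d : ℕ} (x : Fin d → ℚ) : EuclideanSpace ℝ (Fin d) :=
  WithLp.toLp 2 fun i => (x i : ℝ)

/-- Euclidean distance from a rational vector to a set of rational vectors (the infimum of
distances to elements of the set; meaningful for nonempty sets). -/
noncomputable def distToSet {d : ℕ} (x : Fin d → ℚ) (S : Set (Fin d → ℚ)) : ℝ :=
  Metric.infDist (toEuclid x) (toEuclid '' S)

/-- `f : ℕ → ℕ` is nondecreasing: `f n ≥ n` for all `n`, and `f n < f m` for all `n < m`. -/
def Nondecreasing (f : ℕ → ℕ) : Prop := (∀ n, n ≤ f n) ∧ ∀ n m, n < m → f n < f m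

/-! Removing simple cycles from a path writes the reached vector as the source vector, plus one
vector `x i` in the closed cone of each component, plus the effect of a simple walk, which is
bounded by the size. Components are visited in order, so when a cycle of component `j` is removed,
later summands are still zero and the partial sums from `j` on equal the current nonnegative vector
up to source and simple walk. Hence all partial sums are at least minus the size, whatever the
number of components (`Decomposes.step`).

The same decomposition of a forward-diagonal run gives a positive vector in the first closed cone;
Carathéodory and Cramer replace it by some `y` with entries between `1` and a polynomial bound
(`exists_small_mem_closedCone`). Adding a multiple of `y` to the first summand lifts every partial
sum above zero, and a tiny multiple of all cycle effects makes all coefficients positive, so a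
nearby point of the sequential cone results (`exists_mem_seqCone_near`). -/

/-! ### Small nonnegative solutions of linear inequalities -/

/-- Conic Carathéodory theorem: a nonnegative combination of finitely many vectors can be rewritten
as a nonnegative combination supported on a linearly independent subfamily. -/
theorem exists_linearIndepOn_nonneg_combination {ι M : Type*} [AddCommGroup M] [Module ℚ M]
    (f : ι → M) (S : Finset ι) :
    ∀ r : ι → ℚ, (∀ a ∈ S, 0 ≤ r a) → ∃ T ⊆ S, LinearIndepOn ℚ f (T : Set ι) ∧
      ∃ r' : ι → ℚ, (∀ a ∈ T, 0 ≤ r' a) ∧ ∑ a ∈ T, r' a • f a = ∑ a ∈ S, r a • f a := by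
  classical
  induction S using Finset.strongInduction with
  | H S ih =>
    intro r hr
    by_cases hli : LinearIndepOn ℚ f (S : Set ι)
    · exact ⟨S, subset_rfl, hli, r, hr, rfl⟩
    obtain ⟨g, hg0, a₀, ha₀, hga₀⟩ : ∃ g : ι → ℚ, ∑ a ∈ S, g a • f a = 0 ∧ ∃ a ∈ S, 0 < g a := by
      rw [linearIndepOn_finset_iff] at hli
      push Not at hli
      obtain ⟨g, hg0, a, ha, hga⟩ := hli
      rcases lt_or_gt_of_ne hga with h | h
      · exact ⟨fun x => -g x, by simp [neg_smul, hg0], a, ha, by simpa using h⟩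
      · exact ⟨g, hg0, a, ha, h⟩
    -- Subtracting the relation `g` scaled by the least ratio `r a / g a` kills the coefficient of
    -- `m` and keeps the others nonnegative.
    obtain ⟨m, hm, hmin⟩ := Finset.exists_min_image (S.filter fun a => 0 < g a)
      (fun a => r a / g a) ⟨a₀, by simp [ha₀, hga₀]⟩
    rw [Finset.mem_filter] at hm
    obtain ⟨hmS, hgm⟩ := hm
    set c := r m / g m with hc
    have hc0 : 0 ≤ c := div_nonneg (hr m hmS) hgm.le
    have hnew : ∀ a ∈ S, 0 ≤ r a - c * g a := by
      intro a ha
      rcases lt_or_ge 0 (g a) with h | h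
      · have := hmin a (by simp [ha, h])
        have := (le_div_iff₀ h).1 this
        linarith
      · have := hr a ha
        nlinarith
    have hmz : r m - c * g m = 0 := by rw [hc]; field_simp; ring
    obtain ⟨T, hT, hTli, r', hr', hs⟩ := ih (S.erase m) (Finset.erase_ssubset hmS)
      (fun a => r a - c * g a) fun a ha => hnew a (Finset.mem_of_mem_erase ha)
    refine ⟨T, hT.trans (Finset.erase_subset _ _), hTli, r', hr', hs.trans ?_⟩
    rw [Finset.sum_erase _ (by simp [hmz])]
    simp only [sub_smul, mul_smul, Finset.sum_sub_distrib, ← Finset.smul_sum, hg0]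
    simp

/-- Cramer bound: the solution of a regular linear system with small integer coefficients and
right-hand side `1` is small. -/
theorem abs_le_of_mulVec_eq_one {A : Matrix (Fin 3) (Fin 3) ℤ} {N : ℕ} (hN : 1 ≤ N)
    (hA : ∀ i j, |A i j| ≤ N) (hdet : A.det ≠ 0) {x : Fin 3 → ℚ}
    (hx : (A.map (Int.cast : ℤ → ℚ)).mulVec x = 1) (i : Fin 3) : |x i| ≤ 6 * N ^ 3 := by
  set B := A.map (Int.cast : ℤ → ℚ) with hB
  have hBdet : B.det = (A.det : ℚ) := by
    rw [hB]; exact (Int.cast_det A).symm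
  have hcr : B.cramer 1 = B.det • x := by
    rw [Matrix.cramer_eq_adjugate_mulVec, ← hx, Matrix.mulVec_mulVec, Matrix.adjugate_mul,
      Matrix.smul_mulVec, Matrix.one_mulVec]
  have hle : |B.cramer 1 i| ≤ 6 * (N : ℚ) ^ 3 := by
    rw [Matrix.cramer_apply]
    have := Matrix.det_le (A := B.updateCol i 1) (abv := AbsoluteValue.abs) (x := (N : ℚ)) (by
      intro k l
      rw [Matrix.updateCol_apply]
      split_ifs
      · simpa using hN
      · have := hA k l
        simp only [hB, Matrix.map_apply, AbsoluteValue.abs_apply]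
        exact_mod_cast this)
    simpa [Nat.factorial] using this
  have hd : (1 : ℚ) ≤ |B.det| := by
    rw [hBdet]
    exact_mod_cast Int.one_le_abs hdet
  have h2 : |B.cramer 1 i| = |B.det| * |x i| := by rw [hcr]; simp [abs_mul]
  nlinarith [abs_nonneg (x i)]

/-- If a nonnegative combination of linearly independent small integer vectors equals `1`, then
its coefficients are small and there are at most three of them. -/
theorem coeff_le_of_linearIndepOn {ι : Type*} (f : ι → Fin 3 → ℤ) {N : ℕ} (hN : 1 ≤ N)
    (t : Set ι) (hf : ∀ a ∈ t, ∀ i, |f a i| ≤ N)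
    (ht : Submodule.span ℚ ((fun a i => (f a i : ℚ)) '' t) = ⊤) (T : Finset ι) (hT : (T : Set ι) ⊆ t)
    (hli : LinearIndepOn ℚ (fun a i => (f a i : ℚ)) (T : Set ι)) (r : ι → ℚ)
    (hr : ∑ a ∈ T, r a • (fun i => (f a i : ℚ)) = 1) :
    T.card ≤ 3 ∧ ∀ a ∈ T, |r a| ≤ 6 * N ^ 3 := by
  classical
  set F : ι → Fin 3 → ℚ := fun a i => (f a i : ℚ) with hF
  have hcard : T.card ≤ 3 := by
    have h := LinearIndependent.fintype_card_le_finrank (R := ℚ) hli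
    simpa using h
  refine ⟨hcard, fun a ha => ?_⟩
  -- Completing `T` to a basis inside `t` gives a square integer matrix; the added coefficients are
  -- zero.
  obtain ⟨b, hbt, hTb, hspan, hb⟩ := exists_linearIndepOn_extension hli hT
  have htop : ⊤ ≤ Submodule.span ℚ (Set.range fun x : b => F x) := by
    rw [← ht, Submodule.span_le]
    have : (Set.range fun x : b => F x) = F '' b := by
      ext; simp
    rwa [this]
  let bas := Module.Basis.mk hb htop
  let e : b ≃ Fin 3 := bas.indexEquiv (Pi.basisFun ℚ (Fin 3))
  have : Fintype b := Fintype.ofEquiv _ e.symm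
  let A : Matrix (Fin 3) (Fin 3) ℤ := fun i j => f (e.symm j) i
  have hcols : LinearIndependent ℚ (A.map (Int.cast : ℤ → ℚ)).col := by
    have := hb.comp e.symm e.symm.injective
    exact this
  have hdet : A.det ≠ 0 := by
    have h := (Matrix.isUnit_iff_isUnit_det _).1 (Matrix.linearIndependent_cols_iff_isUnit.1 hcols)
    intro h0
    have h1 : (A.map (Int.cast : ℤ → ℚ)).det = (A.det : ℚ) := (Int.cast_det A).symm
    rw [h1, h0] at h
    simp at h
  let r₀ : ι → ℚ := fun a => if a ∈ T then r a else 0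
  have key := abs_le_of_mulVec_eq_one hN (A := A) (fun i j => hf _ (hbt (e.symm j).2) i) hdet
    (x := fun j => r₀ (e.symm j)) (by
      rw [← hr]
      funext i
      change ∑ j, (f (e.symm j) i : ℚ) * r₀ (e.symm j) = _
      rw [e.symm.sum_comp (fun x : b => (f x i : ℚ) * r₀ x)]
      have : ∑ x : b, (f x i : ℚ) * r₀ x = ∑ x ∈ T, (f x i : ℚ) * r₀ x := by
        rw [← Finset.sum_subtype b.toFinset (by simp) fun x => (f x i : ℚ) * r₀ x]
        refine (Finset.sum_subset (fun x hx => ?_) fun x _ hx => ?_).symm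
        · simpa using hTb hx
        · simp [r₀, hx]
      rw [this, Finset.sum_apply]
      refine Finset.sum_congr rfl fun x hx => ?_
      simp [r₀, hx, mul_comm])
    (e ⟨a, hTb ha⟩)
  simpa [r₀, ha] using key

/-- If a nonnegative combination of small integer vectors is positive on every coordinate, then
some nonnegative combination of them is at least `1` on every coordinate and small. -/
theorem exists_small_combination_ge_one (E : Finset (Fin 3 → ℤ)) {N : ℕ} (hN : 1 ≤ N)
    (hE : ∀ e ∈ E, ∀ i, |e i| ≤ N) (r : (Fin 3 → ℤ) → ℚ) (hr : ∀ e ∈ E, 0 ≤ r e)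
    (hpos : ∀ i, 0 < ∑ e ∈ E, r e * e i) :
    ∃ r' : (Fin 3 → ℤ) → ℚ, (∀ e ∈ E, 0 ≤ r' e) ∧
      ∀ i, 1 ≤ ∑ e ∈ E, r' e * e i ∧ ∑ e ∈ E, r' e * e i ≤ 18 * N ^ 4 := by
  classical
  -- The vectors `-e_j` act as slack variables, turning "at least `1`" into "equal to `1`".
  let f : (Fin 3 → ℤ) ⊕ Fin 3 → Fin 3 → ℤ := Sum.elim id fun j => -Pi.single j 1
  let F : (Fin 3 → ℤ) ⊕ Fin 3 → Fin 3 → ℚ := fun a i => (f a i : ℚ)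
  let S : Finset ((Fin 3 → ℤ) ⊕ Fin 3) := E.disjSum Finset.univ
  obtain ⟨c, hc0, hc⟩ : ∃ c : ℚ, 0 ≤ c ∧ ∀ i, 1 ≤ c * ∑ e ∈ E, r e * e i := by
    refine ⟨∑ i, (∑ e ∈ E, r e * e i)⁻¹, Finset.sum_nonneg fun i _ => (inv_pos.2 (hpos i)).le,
      fun i => ?_⟩
    rw [← div_le_iff₀ (hpos i), one_div]
    exact Finset.single_le_sum (f := fun i => (∑ e ∈ E, r e * (e i : ℚ))⁻¹)
      (fun j _ => (inv_pos.2 (hpos j)).le) (Finset.mem_univ i)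
  obtain ⟨T, hTS, hli, r', hr', hsum⟩ := exists_linearIndepOn_nonneg_combination F S
    (Sum.elim (fun e => c * r e) fun j => c * (∑ e ∈ E, r e * e j) - 1) (by
      rintro (e | j) h
      · exact mul_nonneg hc0 (hr e (by simpa [S] using h))
      · simpa using hc j)
  have hone : ∑ a ∈ T, r' a • F a = 1 := by
    rw [hsum, Finset.sum_disjSum]
    funext i
    simp [F, f, Finset.mul_sum, mul_assoc, Pi.single_apply]
  have hf : ∀ a ∈ (S : Set _), ∀ i, |f a i| ≤ N := by
    rintro (e | j) h i
    · exact hE e (by simpa [S] using h) i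
    · simp only [f, Sum.elim_inr, Pi.neg_apply, abs_neg, Pi.single_apply]
      split_ifs <;> simp [hN]
  have hspan : Submodule.span ℚ (F '' S) = ⊤ := by
    rw [eq_top_iff, ← (Pi.basisFun ℚ (Fin 3)).span_eq, Submodule.span_le]
    rintro _ ⟨j, rfl⟩
    have : (Pi.basisFun ℚ (Fin 3)) j = -F (Sum.inr j) := by
      funext i; simp [F, f, Pi.single_apply]
    rw [this]
    exact neg_mem (Submodule.subset_span ⟨Sum.inr j, by simp [S], rfl⟩)
  obtain ⟨hcard, hcoef⟩ := coeff_le_of_linearIndepOn f hN _ hf hspan T (by exact_mod_cast hTS)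
    hli r' hone
  let r₀ : (Fin 3 → ℤ) → ℚ := fun e => if Sum.inl e ∈ T then r' (Sum.inl e) else 0
  have hr₀ : ∀ e, 0 ≤ r₀ e := by
    intro e; dsimp only [r₀]; split_ifs with h
    · exact hr' _ h
    · exact le_rfl
  have hsplit : ∀ i, ∑ a ∈ T, r' a * F a i = ∑ e ∈ E, r₀ e * e i +
      ∑ j, (if Sum.inr j ∈ T then r' (Sum.inr j) else 0) * (F (Sum.inr j) i) := by
    intro i
    have h1 : ∑ a ∈ T, r' a * F a i = ∑ a ∈ S, (if a ∈ T then r' a else 0) * F a i := by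
      rw [← Finset.sum_subset hTS]
      · exact Finset.sum_congr rfl fun a ha => by simp [ha]
      · intro a _ ha; simp [ha]
    rw [h1, Finset.sum_disjSum]
    rfl
  have hone' : ∀ i, ∑ a ∈ T, r' a * F a i = 1 := fun i => by
    have := congrFun hone i
    simpa [Finset.sum_apply] using this
  refine ⟨r₀, fun e _ => hr₀ e, fun i => ⟨?_, ?_⟩⟩
  · have h := hsplit i
    rw [hone'] at h
    have : ∑ j, (if Sum.inr j ∈ T then r' (Sum.inr j) else 0) * (F (Sum.inr j) i) ≤ 0 := by
      refine Finset.sum_nonpos fun j _ => mul_nonpos_of_nonneg_of_nonpos ?_ ?_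
      · split_ifs with h
        · exact hr' _ h
        · exact le_rfl
      · simp only [F, f, Sum.elim_inr, Pi.neg_apply, Pi.single_apply]
        split_ifs <;> simp
    linarith
  -- At most three coefficients survive, each at most `6 * N ^ 3` and multiplied by an entry at most
  -- `N`.
  · have h1 : ∑ e ∈ E, r₀ e * e i ≤ ∑ a ∈ S, if a ∈ T then 6 * (N : ℚ) ^ 4 else 0 := by
      rw [Finset.sum_disjSum]
      refine le_add_of_le_of_nonneg (Finset.sum_le_sum fun e he => ?_)
        (Finset.sum_nonneg fun j _ => by positivity)
      dsimp only [r₀]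
      split_ifs with h
      · have h2 := hcoef _ h
        have h3 : |(e i : ℚ)| ≤ N := by exact_mod_cast hE e he i
        calc r' (Sum.inl e) * e i ≤ |r' (Sum.inl e)| * |(e i : ℚ)| := by
              rw [← abs_mul]; exact le_abs_self _
          _ ≤ (6 * N ^ 3) * N := by gcongr
          _ = 6 * (N : ℚ) ^ 4 := by ring
      · simp
    refine h1.trans ?_
    rw [← Finset.sum_filter, Finset.filter_mem_eq_inter, Finset.inter_eq_right.2 hTS,
      Finset.sum_const, nsmul_eq_mul]
    have : (T.card : ℚ) ≤ 3 := by exact_mod_cast hcard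
    nlinarith [show (0 : ℚ) ≤ (N : ℚ) ^ 4 by positivity]

/-! ### Walks, simple cycles and closed cones -/

namespace VASS

variable {d : ℕ} {σ : Type*}

/-- `V.Walk p ρ q`: the list of transitions `ρ` is a walk from `p` to `q` in the state graph. -/
def Walk (V : VASS d σ) : σ → List (Transition d σ) → σ → Prop
  | p, [], q => p = q
  | p, t :: ρ, q => t ∈ V.trans ∧ t.src = p ∧ Walk V t.tgt ρ q

theorem Walk.mem_trans {V : VASS d σ} {ρ : List (Transition d σ)} :
    ∀ {p q : σ}, V.Walk p ρ q → ∀ t ∈ ρ, t ∈ V.trans := by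
  induction ρ with
  | nil => simp
  | cons t ρ ih =>
    rintro p q ⟨h, -, hw⟩ u hu
    rcases List.mem_cons.1 hu with rfl | hu
    · exact h
    · exact ih hw u hu

theorem walk_append {V : VASS d σ} {ρ₁ ρ₂ : List (Transition d σ)} :
    ∀ {p q : σ}, V.Walk p (ρ₁ ++ ρ₂) q ↔ ∃ r, V.Walk p ρ₁ r ∧ V.Walk r ρ₂ q := by
  induction ρ₁ with
  | nil => simp [Walk]
  | cons t ρ ih => simp [Walk, ih, and_assoc]

/-- A walk can be fired from every sufficiently large configuration. -/
theorem Walk.exists_path {V : VASS d σ} {ρ : List (Transition d σ)} :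
    ∀ {p q : σ}, V.Walk p ρ q → q ∈ V.states → ∃ B : ℕ, ∀ c : Config d σ, c.state = p →
      (∀ i, B ≤ c.vec i) → ∃ c' : Config d σ, c'.state = q ∧ V.Path c ρ c' := by
  induction ρ with
  | nil =>
    rintro p q rfl hq
    exact ⟨0, fun c hc _ => ⟨c, hc, Path.nil c (hc ▸ hq)⟩⟩
  | cons t ρ ih =>
    rintro p q ⟨ht, rfl, hw⟩ hq
    obtain ⟨B, hB⟩ := ih hw hq
    refine ⟨B + vecNorm t.eff, fun c hc hcB => ?_⟩
    have hle : ∀ i, (t.eff i).natAbs ≤ vecNorm t.eff := fun i =>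
      Finset.single_le_sum (f := fun i => (t.eff i).natAbs) (fun _ _ => Nat.zero_le _)
        (Finset.mem_univ i)
    obtain ⟨c', hc', hp⟩ := hB ⟨t.tgt, fun i => ((c.vec i : ℤ) + t.eff i).toNat⟩ rfl fun i => by
      have := hle i
      have := hcB i
      dsimp only
      omega
    refine ⟨c', hc', Path.cons ⟨ht, hc.symm, rfl, fun i => ?_⟩ hp⟩
    have := hle i
    have := hcB i
    dsimp only
    omega

/-- Simple cycles are defined through paths of configurations; a closed walk becomes such a path
when fired from a large enough vector. -/
theorem Walk.isSimpleCycle {V : VASS d σ} {ρ : List (Transition d σ)} {p : σ}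
    (h : V.Walk p ρ p) (hp : p ∈ V.states) (hne : ρ ≠ []) (hnd : (ρ.map Transition.src).Nodup) :
    V.IsSimpleCycle ρ := by
  obtain ⟨B, hB⟩ := h.exists_path hp
  obtain ⟨c', hc', hpath⟩ := hB ⟨p, fun _ => B⟩ rfl fun _ => le_rfl
  exact ⟨hne, ⟨_, _, hc'.symm, hpath⟩, hnd⟩

theorem effect_append (ρ₁ ρ₂ : List (Transition d σ)) :
    effect (ρ₁ ++ ρ₂) = effect ρ₁ + effect ρ₂ := by
  simp [effect]

/-- Distinct sources force distinct transitions, so each norm is counted at most once. -/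
theorem abs_effect_le (V : VASS d σ) {ρ : List (Transition d σ)} (hm : ∀ t ∈ ρ, t ∈ V.trans)
    (hnd : (ρ.map Transition.src).Nodup) (i : Fin d) : |effect ρ i| ≤ V.size := by
  classical
  have h1 : ∀ ρ : List (Transition d σ),
      |effect ρ i| ≤ ((ρ.map fun t => vecNorm t.eff).sum : ℕ) := by
    intro ρ
    induction ρ with
    | nil => simp [effect]
    | cons t ρ ih =>
      have h2 : effect (t :: ρ) i = t.eff i + effect ρ i := by simp [effect]
      have h3 : (t.eff i).natAbs ≤ vecNorm t.eff :=
        Finset.single_le_sum (f := fun i => (t.eff i).natAbs) (fun _ _ => Nat.zero_le _)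
          (Finset.mem_univ i)
      rw [h2, List.map_cons, List.sum_cons]
      have := abs_add_le (t.eff i) (effect ρ i)
      have := Int.natCast_natAbs (t.eff i)
      rw [Nat.cast_add]
      omega
  refine (h1 ρ).trans ?_
  rw [← List.sum_toFinset _ hnd.of_map]
  have h4 : ∑ t ∈ ρ.toFinset, vecNorm t.eff ≤ ∑ t ∈ V.trans, vecNorm t.eff :=
    Finset.sum_le_sum_of_subset fun t ht => hm t (List.mem_toFinset.1 ht)
  exact_mod_cast h4.trans (Nat.le_add_right _ _)

/-- The nonnegative combinations of the effects of simple cycles of `V`. -/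
def closedCone (V : VASS d σ) : Set (Fin d → ℚ) :=
  {x | ∃ r : (Fin d → ℤ) → ℚ, (∀ e ∈ V.simpleCycleEffects, 0 ≤ r e) ∧
    x = ∑ e ∈ V.simpleCycleEffects_finite.toFinset, r e • (fun i => (e i : ℚ))}

theorem zero_mem_closedCone (V : VASS d σ) : (0 : Fin d → ℚ) ∈ V.closedCone :=
  ⟨0, fun _ _ => le_rfl, by simp⟩

theorem add_mem_closedCone {V : VASS d σ} {x y : Fin d → ℚ} (hx : x ∈ V.closedCone)
    (hy : y ∈ V.closedCone) : x + y ∈ V.closedCone := by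
  obtain ⟨r, hr, rfl⟩ := hx
  obtain ⟨r', hr', rfl⟩ := hy
  exact ⟨r + r', fun e he => add_nonneg (hr e he) (hr' e he), by
    simp [add_smul, Finset.sum_add_distrib]⟩

theorem smul_mem_closedCone {V : VASS d σ} {x : Fin d → ℚ} (hx : x ∈ V.closedCone) {c : ℚ}
    (hc : 0 ≤ c) : c • x ∈ V.closedCone := by
  obtain ⟨r, hr, rfl⟩ := hx
  exact ⟨fun e => c * r e, fun e he => mul_nonneg hc (hr e he), by
    simp only [mul_smul, Finset.smul_sum]⟩

theorem mem_closedCone_of_mem_simpleCycleEffects {V : VASS d σ} {e : Fin d → ℤ}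
    (he : e ∈ V.simpleCycleEffects) : (fun i => (e i : ℚ)) ∈ V.closedCone := by
  classical
  refine ⟨fun x => if x = e then 1 else 0, fun x _ => by positivity, ?_⟩
  simp [ite_smul, he]

/-- The sum of the effects of all simple cycles of `V`. -/
noncomputable def cycleSum (V : VASS d σ) : Fin d → ℚ :=
  ∑ e ∈ V.simpleCycleEffects_finite.toFinset, fun i => (e i : ℚ)

theorem add_smul_cycleSum_mem_cone {V : VASS d σ} {x : Fin d → ℚ} (hx : x ∈ V.closedCone) {ε : ℚ}
    (hε : 0 < ε) : x + ε • V.cycleSum ∈ V.cone := by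
  obtain ⟨r, hr, rfl⟩ := hx
  exact ⟨fun e => r e + ε, fun e he => add_pos_of_nonneg_of_pos (hr e he) hε, by
    simp only [add_smul, Finset.sum_add_distrib, cycleSum, Finset.smul_sum]⟩

theorem abs_le_of_mem_simpleCycleEffects {V : VASS d σ} {e : Fin d → ℤ}
    (he : e ∈ V.simpleCycleEffects) (i : Fin d) : |e i| ≤ V.size := by
  obtain ⟨π, ⟨-, ⟨c, c', -, hp⟩, hnd⟩, rfl⟩ := he
  exact V.abs_effect_le hp.mem_trans hnd i

/-! ### Decomposition of paths in a sequential VASS -/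

namespace Sequential

variable {V : VASS d σ} (S : V.Sequential)

theorem index_unique {q : σ} {i j : Fin (S.m + 1)} (hi : q ∈ (S.comp i).states)
    (hj : q ∈ (S.comp j).states) : i = j := by
  by_contra h
  exact Finset.disjoint_left.1 (S.disjoint i j h) hi hj

theorem comp_trans_subset (i : Fin (S.m + 1)) : (S.comp i).trans ⊆ V.trans := fun t ht =>
  (S.trans_eq t).2 (Or.inl ⟨i, ht⟩)

theorem comp_size_le (i : Fin (S.m + 1)) : (S.comp i).size ≤ V.size :=
  Nat.add_le_add (Finset.sum_le_sum_of_subset (S.comp_trans_subset i))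
    (Finset.card_le_card (S.comp_trans_subset i))

/-- Transitions never decrease the index of the component, and those which keep it are transitions
of that component. -/
theorem index_le_of_mem_trans {t : Transition d σ} (ht : t ∈ V.trans) {i j : Fin (S.m + 1)}
    (hi : t.src ∈ (S.comp i).states) (hj : t.tgt ∈ (S.comp j).states) :
    i ≤ j ∧ (i = j → t ∈ (S.comp i).trans) := by
  rcases (S.trans_eq t).1 ht with ⟨a, ha⟩ | ⟨a, rfl⟩
  · obtain rfl := S.index_unique hi ((S.comp a).src_mem t ha)
    obtain rfl := S.index_unique hj ((S.comp i).tgt_mem t ha)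
    exact ⟨le_rfl, fun _ => ha⟩
  · obtain rfl := S.index_unique hi (S.bridge_src a)
    obtain rfl := S.index_unique hj (S.bridge_tgt a)
    have h := Fin.castSucc_lt_succ (i := a)
    exact ⟨h.le, fun h' => absurd h' h.ne⟩

theorem index_le_of_walk {ρ : List (Transition d σ)} {j : Fin (S.m + 1)} {q : σ}
    (hj : q ∈ (S.comp j).states) :
    ∀ {p : σ} {i : Fin (S.m + 1)}, p ∈ (S.comp i).states → V.Walk p ρ q →
      i ≤ j ∧ (i = j → (S.comp i).Walk p ρ q) := by
  induction ρ with
  | nil =>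
    rintro p i hi rfl
    exact ⟨(S.index_unique hi hj).le, fun _ => rfl⟩
  | cons t ρ ih =>
    rintro p i hi ⟨ht, rfl, hw⟩
    obtain ⟨a, ha⟩ := (S.states_eq _).1 (V.tgt_mem t ht)
    obtain ⟨h1, h2⟩ := S.index_le_of_mem_trans ht hi ha
    obtain ⟨h3, h4⟩ := ih ha hw
    refine ⟨h1.trans h3, fun h => ?_⟩
    obtain rfl : i = a := le_antisymm h1 (h ▸ h3)
    exact ⟨h2 rfl, rfl, h4 h⟩

/-- Component indices never decrease along a walk, so a closed walk stays in one component. -/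
theorem effect_mem_closedCone {ρ : List (Transition d σ)} {p : σ} {i : Fin (S.m + 1)}
    (hp : p ∈ (S.comp i).states) (hw : V.Walk p ρ p) (hne : ρ ≠ [])
    (hnd : (ρ.map Transition.src).Nodup) :
    (fun a => (effect ρ a : ℚ)) ∈ (S.comp i).closedCone :=
  mem_closedCone_of_mem_simpleCycleEffects
    ⟨ρ, ((S.index_le_of_walk hp hp hw).2 rfl).isSimpleCycle hp hne hnd, rfl⟩

/-- The vector of `c` is the vector of `s` plus nonnegative combinations of effects of simple
cycles of the components, with partial sums bounded from below, plus the effect of a simple walk. -/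
def Decomposes (s c : Config d σ) : Prop :=
  ∃ (j : Fin (S.m + 1)) (x : Fin (S.m + 1) → Fin d → ℚ) (ρ : List (Transition d σ)),
    c.state ∈ (S.comp j).states ∧ (∀ i, x i ∈ (S.comp i).closedCone) ∧ (∀ i, j < i → x i = 0) ∧
    (∀ i a, -(V.sizeWith s : ℚ) ≤ (∑ l ∈ Finset.Iic i, x l) a) ∧
    V.Walk s.state ρ c.state ∧ (ρ.map Transition.src).Nodup ∧ c.state ∉ ρ.map Transition.src ∧
    ∀ a, (c.vec a : ℚ) = s.vec a + (∑ i, x i) a + effect ρ a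

theorem Decomposes.refl {s : Config d σ} (hs : s.state ∈ V.states) : S.Decomposes s s := by
  obtain ⟨j, hj⟩ := (S.states_eq _).1 hs
  exact ⟨j, 0, [], hj, fun i => zero_mem_closedCone _, fun _ _ => rfl, by simp, rfl, by simp,
    by simp, by simp [effect]⟩

theorem vec_le_norm (s : Config d σ) (a : Fin d) : s.vec a ≤ s.norm := by
  have := Finset.single_le_sum (f := fun i => ((s.vec i : ℤ)).natAbs) (fun _ _ => Nat.zero_le _)
    (Finset.mem_univ a)
  simpa [Config.norm, vecNorm] using this

/-- The new transition extends the simple walk; if this revisits a state, the closed suffix is a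
simple cycle, whose effect moves into the summand of the current component. -/
theorem Decomposes.step {s c c' : Config d σ} {t : Transition d σ} (h : S.Decomposes s c)
    (ht : V.Step c t c') : S.Decomposes s c' := by
  classical
  obtain ⟨j, x, ρ, hj, hx, hx0, hpart, hw, hnd, hnot, hvec⟩ := h
  obtain ⟨htV, hsrc, htgt, hstep⟩ := ht
  obtain ⟨j', hj'⟩ := (S.states_eq _).1 (V.tgt_mem t htV)
  have hjj' := (S.index_le_of_mem_trans htV (hsrc ▸ hj) hj').1
  rw [htgt] at hj'
  have hw' : V.Walk s.state (ρ ++ [t]) c'.state :=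
    walk_append.2 ⟨_, hw, htV, hsrc, htgt⟩
  have hnd' : ((ρ ++ [t]).map Transition.src).Nodup := by
    rw [List.map_append, List.nodup_append]
    refine ⟨hnd, by simp, ?_⟩
    rintro a ha b hb rfl
    simp only [List.map_cons, List.map_nil, List.mem_singleton] at hb
    exact hnot (hsrc ▸ hb ▸ ha)
  have hvec' : ∀ a, (c'.vec a : ℚ) = s.vec a + (∑ i, x i) a + effect (ρ ++ [t]) a := by
    intro a
    have h1 : (c'.vec a : ℚ) = c.vec a + t.eff a := by exact_mod_cast hstep a
    rw [h1, hvec, effect_append]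
    simp [effect, add_assoc]
  by_cases hmem : c'.state ∈ (ρ ++ [t]).map Transition.src
  swap
  · exact ⟨j', x, _, hj', hx, fun i hi => hx0 i (hjj'.trans_lt hi), hpart, hw', hnd', hmem, hvec'⟩
  -- `u` leaves the earlier visit of `c'.state`, so the walk is cut just before `u`.
  obtain ⟨u, hu, huc⟩ := List.mem_map.1 hmem
  obtain ⟨ρ₁, ρ₂, hρ⟩ := List.append_of_mem hu
  rw [hρ] at hw' hnd' hvec'
  obtain ⟨r, hw₁, hw₂⟩ := walk_append.1 hw'
  obtain rfl : r = c'.state := by rw [← hw₂.2.1, huc]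
  rw [List.map_append, List.nodup_append] at hnd'
  obtain ⟨hnd₁, hnd₂, hdisj⟩ := hnd'
  have hcyc := S.effect_mem_closedCone hj' hw₂ (by simp) hnd₂
  set y : Fin d → ℚ := fun a => (effect (u :: ρ₂) a : ℚ) with hy
  set x' : Fin (S.m + 1) → Fin d → ℚ := x + Pi.single j' y with hx'
  have hsum : ∀ T : Finset (Fin (S.m + 1)), ∑ l ∈ T, x' l =
      ∑ l ∈ T, x l + if j' ∈ T then y else 0 := by
    intro T
    simp only [hx', Pi.add_apply, Finset.sum_add_distrib, Finset.sum_pi_single']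
  have hx0' : ∀ i, j' < i → x' i = 0 := fun i hi => by
    rw [hx', Pi.add_apply, hx0 i (hjj'.trans_lt hi), Pi.single_eq_of_ne hi.ne', add_zero]
  have hvec'' : ∀ a, (c'.vec a : ℚ) =
      s.vec a + (∑ i, x' i) a + effect ρ₁ a := by
    intro a
    rw [hvec', hsum, effect_append]
    simp only [Finset.mem_univ, if_true, Pi.add_apply, hy]
    push_cast
    ring
  refine ⟨j', x', ρ₁, hj', fun i => ?_, hx0', fun i a => ?_, hw₁, hnd₁, ?_, hvec''⟩
  · rw [hx', Pi.add_apply]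
    refine add_mem_closedCone (hx i) ?_
    by_cases hi : i = j'
    · subst hi; rwa [Pi.single_eq_same]
    · rw [Pi.single_eq_of_ne hi]; exact zero_mem_closedCone _
  -- Partial sums below `j'` are unchanged. From `j'` on they equal the full sum, bounded below
  -- because `c'.vec` is nonnegative.
  · rcases lt_or_ge i j' with hi | hi
    · rw [hsum, if_neg (by simpa using hi), add_zero]
      exact hpart i a
    · have h1 : ∑ l ∈ Finset.Iic i, x' l = ∑ l, x' l :=
        Finset.sum_subset (Finset.subset_univ _) fun l _ hl =>
          hx0' l (hi.trans_lt (by simpa using hl))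
      have h2 := hvec'' a
      have h3 : |(effect ρ₁ a : ℚ)| ≤ V.size := by
        exact_mod_cast V.abs_effect_le hw₁.mem_trans hnd₁ a
      have h4 : (s.vec a : ℚ) ≤ s.norm := by exact_mod_cast vec_le_norm s a
      have h5 : (V.sizeWith s : ℚ) = V.size + s.norm := by simp [sizeWith]
      have h6 : (0 : ℚ) ≤ c'.vec a := by positivity
      rw [h1]
      have := le_abs_self (effect ρ₁ a : ℚ)
      linarith
  · exact fun hmem => hdisj _ hmem _ (by simp) huc.symm

theorem Decomposes.path {s c c' : Config d σ} {π : List (Transition d σ)} (h : S.Decomposes s c)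
    (hp : V.Path c π c') : S.Decomposes s c' := by
  induction hp with
  | nil => exact h
  | cons ht _ ih => exact ih (h.step S ht)

/-- If `(V, s)` is forward-diagonal, then the closed cone of the first component has an element
which is positive on every coordinate. -/
theorem exists_pos_mem_closedCone {s : Config d σ} (hs : s.state ∈ (S.comp 0).states)
    (h : V.ForwardDiagonal s) : ∃ y ∈ (S.comp 0).closedCone, ∀ a, 0 < y a := by
  obtain ⟨Δ, hΔ, π, hp⟩ := h
  obtain ⟨j, x, ρ, hj, hx, hx0, -, hw, hnd, hnot, hvec⟩ :=
    (Decomposes.refl S ((S.states_eq _).2 ⟨0, hs⟩)).path S hp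
  obtain rfl := S.index_unique hs hj
  -- The walk ends at `s.state`, which cannot be a source on it, so it is empty.
  obtain rfl : ρ = [] := by
    cases ρ with
    | nil => rfl
    | cons t ρ => exact absurd (by simp [hw.2.1]) hnot
  refine ⟨x 0, hx 0, fun a => ?_⟩
  have h1 := hvec a
  rw [Finset.sum_eq_single 0 (fun l _ hl => hx0 l (Fin.pos_iff_ne_zero.2 hl)) (by simp)] at h1
  have h2 : (0 : ℚ) < Δ a := by exact_mod_cast hΔ a
  simp [effect] at h1
  linarith

end Sequential
end VASS

/-! ### Perturbation into the sequential cone -/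

namespace VASS.Sequential

/-- If `(V, s)` is forward-diagonal, then the closed cone of the first component has a small element
which is at least `1` on every coordinate. -/
theorem exists_small_mem_closedCone {σ : Type*} {V : VASS 3 σ} (S : V.Sequential) {s : Config 3 σ}
    (hs : s.state ∈ (S.comp 0).states) (h : V.ForwardDiagonal s) {N : ℕ} (hN : 1 ≤ N)
    (hVN : V.size ≤ N) :
    ∃ y ∈ (S.comp 0).closedCone, ∀ a, 1 ≤ y a ∧ y a ≤ 18 * N ^ 4 := by
  obtain ⟨_, ⟨r, hr, rfl⟩, hpos⟩ := S.exists_pos_mem_closedCone hs h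
  obtain ⟨r', hr', hb⟩ := exists_small_combination_ge_one
    (S.comp 0).simpleCycleEffects_finite.toFinset hN (fun e he i => by
      have h1 := abs_le_of_mem_simpleCycleEffects ((Set.Finite.mem_toFinset _).1 he) i
      have h2 := (S.comp_size_le 0).trans hVN
      exact h1.trans (by exact_mod_cast h2)) r
    (fun e he => hr e ((Set.Finite.mem_toFinset _).1 he)) (fun i => by
      simpa [Finset.sum_apply] using hpos i)
  exact ⟨_, ⟨r', fun e he => hr' e ((Set.Finite.mem_toFinset _).2 he), rfl⟩, fun a => by
    simpa [Finset.sum_apply] using hb a⟩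

/-- Vectors of closed cones with partial sums bounded from below can be perturbed to a cascade, by
adding multiples of a vector of the first closed cone which is at least `1` on every coordinate. -/
theorem exists_mem_seqCone_near {d : ℕ} {σ : Type*} {V : VASS d σ} (S : V.Sequential)
    {x : Fin (S.m + 1) → Fin d → ℚ} (hx : ∀ i, x i ∈ (S.comp i).closedCone) {N : ℚ} (hN : 0 ≤ N)
    (hpart : ∀ i a, -N ≤ (∑ l ∈ Finset.Iic i, x l) a) {y : Fin d → ℚ}
    (hy : y ∈ (S.comp 0).closedCone) (hy1 : ∀ a, 1 ≤ y a) :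
    ∃ z ∈ S.seqCone, ∀ a, |z a - (∑ i, x i) a| ≤ (N + 1) * y a + 1 := by
  classical
  -- Scaling by `C⁻¹` keeps every partial sum of the perturbations below `1` in absolute value, for
  -- any number of components.
  let C : ℚ := 1 + ∑ l, ∑ a, |(S.comp l).cycleSum a|
  have hC1 : 1 ≤ C := le_add_of_nonneg_right (by positivity)
  have hC0 : 0 < C := by linarith
  have hsmall : ∀ (T : Finset (Fin (S.m + 1))) (a : Fin d),
      |∑ l ∈ T, C⁻¹ * (S.comp l).cycleSum a| < 1 := by
    intro T a
    rw [← Finset.mul_sum, abs_mul, abs_of_pos (inv_pos.2 hC0), inv_mul_lt_iff₀ hC0, mul_one]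
    calc |∑ l ∈ T, (S.comp l).cycleSum a| ≤ ∑ l ∈ T, |(S.comp l).cycleSum a| :=
          Finset.abs_sum_le_sum_abs _ _
      _ ≤ ∑ l, |(S.comp l).cycleSum a| :=
          Finset.sum_le_sum_of_subset_of_nonneg (Finset.subset_univ _) fun _ _ _ => abs_nonneg _
      _ ≤ ∑ l, ∑ a, |(S.comp l).cycleSum a| := Finset.sum_le_sum fun l _ =>
          Finset.single_le_sum (f := fun a => |(S.comp l).cycleSum a|)
            (fun _ _ => abs_nonneg _) (Finset.mem_univ a)
      _ < C := lt_one_add _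
  -- Placed in component `0`, the multiple of `y` enters every partial sum and raises it by at least
  -- `N + 1`: `N` for the lower bound, `1` for the perturbation.
  let u : Fin (S.m + 1) → Fin d → ℚ := fun i => x i + Pi.single (M := fun _ => Fin d → ℚ) 0
    ((N + 1) • y) i
  have hu : ∀ i, u i ∈ (S.comp i).closedCone := by
    intro i
    refine add_mem_closedCone (hx i) ?_
    by_cases hi : i = 0
    · subst hi
      rw [Pi.single_eq_same]
      exact smul_mem_closedCone hy (by linarith)
    · rw [Pi.single_eq_of_ne hi]; exact zero_mem_closedCone _
  let v : Fin (S.m + 1) → Fin d → ℚ := fun i => u i + C⁻¹ • (S.comp i).cycleSum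
  have hsum : ∀ (T : Finset (Fin (S.m + 1))), 0 ∈ T → ∀ a, (∑ l ∈ T, v l) a =
      (∑ l ∈ T, x l) a + (N + 1) * y a + ∑ l ∈ T, C⁻¹ * (S.comp l).cycleSum a := by
    intro T hT a
    simp only [v, u, Finset.sum_add_distrib, Finset.sum_pi_single', hT, if_true]
    simp [Finset.sum_apply]
  refine ⟨∑ i, v i, ⟨v, fun i => add_smul_cycleSum_mem_cone (hu i) (inv_pos.2 hC0), ?_, rfl⟩, ?_⟩
  · intro i a
    rw [hsum _ (by simp)]
    have h1 := hpart i a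
    have h2 := abs_lt.1 (hsmall (Finset.Iic i) a)
    have h3 : (N + 1) * 1 ≤ (N + 1) * y a := by have := hy1 a; gcongr
    linarith
  · intro a
    rw [hsum _ (by simp)]
    have h2 := abs_lt.1 (hsmall Finset.univ a)
    have h3 : 0 ≤ (N + 1) * y a := mul_nonneg (by linarith) (by linarith [hy1 a])
    rw [abs_le]
    constructor <;> linarith

end VASS.Sequential

/-- The Euclidean norm in dimension three is at most `√3 ≤ 2` times the largest coordinate. -/
theorem distToSet_le {x z : Fin 3 → ℚ} {S : Set (Fin 3 → ℚ)} (hz : z ∈ S) {D : ℚ}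
    (h : ∀ a, |z a - x a| ≤ D) : distToSet x S ≤ 2 * D := by
  have hD : 0 ≤ D := (abs_nonneg _).trans (h 0)
  refine (Metric.infDist_le_dist_of_mem (Set.mem_image_of_mem _ hz)).trans ?_
  rw [EuclideanSpace.dist_eq]
  refine Real.sqrt_le_iff.2 ⟨by positivity, ?_⟩
  have h1 : ∀ a, dist (toEuclid x a) (toEuclid z a) ^ 2 ≤ (D : ℝ) ^ 2 := by
    intro a
    have h2 : dist (toEuclid x a) (toEuclid z a) ≤ D := by
      rw [dist_comm, Real.dist_eq]
      simp only [toEuclid]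
      exact_mod_cast h a
    gcongr
  refine (Finset.sum_le_sum fun a _ => h1 a).trans ?_
  simp only [Finset.sum_const, Finset.card_univ, Fintype.card_fin, nsmul_eq_mul]
  push_cast
  nlinarith [sq_nonneg (D : ℝ)]

theorem nondecreasing_mul_succ_pow : Nondecreasing fun n => 40 * (n + 1) ^ 5 := by
  refine ⟨fun n => ?_, fun n m h => ?_⟩
  · have : n + 1 ≤ (n + 1) ^ 5 := Nat.le_self_pow (by norm_num) _
    dsimp only
    omega
  · dsimp only
    gcongr

theorem lemma31 :
    ∃ P : Polynomial ℕ, Nondecreasing (fun n => P.eval n) ∧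
      ∀ (σ : Type*) (V : VASS 3 σ) (S : V.Sequential) (s : Config 3 σ),
        s.state ∈ (S.comp 0).states → V.ForwardDiagonal s →
          S.seqCone.Nonempty ∧
            ∀ c : Config 3 σ, V.Reachable s c →
              distToSet (fun i => (c.vec i : ℚ)) S.seqCone ≤ ((P.eval (V.sizeWith s) : ℕ) : ℝ) := by
  refine ⟨40 * (Polynomial.X + 1) ^ 5, ?_, fun σ V S s hs hfd => ?_⟩
  · simpa using nondecreasing_mul_succ_pow
  set N := V.sizeWith s with hNdef
  have hVN : V.size ≤ N + 1 := by simp only [hNdef, VASS.sizeWith]; omega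
  obtain ⟨y, hy, hyb⟩ := S.exists_small_mem_closedCone hs hfd (Nat.le_add_left 1 N) hVN
  -- The multiple of `y` contributes at most `18 * (N + 1) ^ 5`; the perturbation, source and simple
  -- walk together add at most `N + 1`.
  have key : ∀ c : Config 3 σ, V.Reachable s c → ∃ z ∈ S.seqCone,
      ∀ a, |z a - c.vec a| ≤ 20 * ((N : ℚ) + 1) ^ 5 := by
    rintro c ⟨π, hp⟩
    obtain ⟨j, x, ρ, -, hx, -, hpart, hw, hnd, -, hvec⟩ :=
      (VASS.Sequential.Decomposes.refl S ((S.states_eq _).2 ⟨0, hs⟩)).path S hp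
    obtain ⟨z, hz, hzx⟩ := S.exists_mem_seqCone_near hx (Nat.cast_nonneg (V.sizeWith s)) hpart hy
      fun a => (hyb a).1
    refine ⟨z, hz, fun a => ?_⟩
    have h1 := hzx a
    have h2 : (N + 1 : ℚ) * y a ≤ (N + 1) * (18 * ((N + 1 : ℕ) : ℚ) ^ 4) := by
      have := (hyb a).2
      gcongr
    have h3 : |(VASS.effect ρ a : ℚ)| ≤ V.size := by
      exact_mod_cast V.abs_effect_le hw.mem_trans hnd a
    have h4 : (s.vec a : ℚ) ≤ s.norm := by exact_mod_cast VASS.Sequential.vec_le_norm s a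
    have h5 : (N : ℚ) = V.size + s.norm := by simp [hNdef, VASS.sizeWith]
    have h6 : (N + 1 : ℚ) ≤ (N + 1) ^ 5 :=
      le_self_pow₀ (by linarith [Nat.cast_nonneg (α := ℚ) N]) (by norm_num)
    have h7 : |z a - c.vec a| ≤ |z a - (∑ i, x i) a| + (s.vec a + |(VASS.effect ρ a : ℚ)|) := by
      rw [hvec a, show z a - (s.vec a + (∑ i, x i) a + VASS.effect ρ a) =
        (z a - (∑ i, x i) a) - (s.vec a + VASS.effect ρ a) by ring]
      refine (abs_sub _ _).trans (add_le_add le_rfl ((abs_add_le _ _).trans ?_))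
      rw [Nat.abs_cast]
    push_cast at h2
    have h8 : (N + 1 : ℚ) * (18 * (N + 1) ^ 4) = 18 * (N + 1) ^ 5 := by ring
    linarith
  refine ⟨?_, fun c hc => ?_⟩
  -- Forward-diagonality itself supplies a reachable configuration.
  · obtain ⟨z, hz, -⟩ := key _ hfd.choose_spec.2
    exact ⟨z, hz⟩
  · obtain ⟨z, hz, hzc⟩ := key c hc
    refine (distToSet_le hz hzc).trans (le_of_eq ?_)
    simp
    ring
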